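/- Let $\sigma_x=\begin{pmatrix}0&1\\1&0\end{pmatrix}$ and, for $n\ge 0$, let $H_n=\sum_{i=0}^{n-2} I^{\otimes i}\otimes(\sigma_x\otimes\sigma_x)\otimes I^{\otimes(n-i-2)}$ on $(\mathbb C^2)^{\otimes n}$ (so $H_n=0$ for $n\le 1$). Let $\theta\in(0,\pi/2)$, let $P_1,P_2$ be the orthogonal projections of $\mathbb C^2$ onto the lines spanned by $(\cos\theta,\sin\theta)$ and $(-\sin\theta,\cos\theta)$, and let $\beta_j=\operatorname{Tr}(\sigma_xP_j)$, i.e. $\beta_1=\sin2\theta$ and $\beta_2=-\sin 2\theta$. There is exactly one probability measure $\mu$ on $\{1,2\}^{\mathbb N}$ (coordinates $x_0,x_1,\dots$) such that for every $n\ge 0$ and all $j_0,\dots,j_{n-1}\in\{1,2\}$ $$\mu\{x: x_0=j_0,\dots,x_{n-1}=j_{n-1}\}=\lim_{b\to+\infty}\frac{\operatorname{Tr}\big(e^{-bH_n}\,P_{j_0}\otimes\cdots\otimes P_{j_{n-1}}\big)}{\operatorname{Tr}\big(e^{-bH_n}\big)} ,$$ where, in particular, all these limits exist (the zero temperature measure).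 Let $A:\{1,2\}\to\mathbb R$ and, for $t\in\mathbb R$ and $n\ge0$, put $$Q_n(t)=\int e^{t(A(x_0)+A(x_1)+\cdots+A(x_n))}\,d\mu(x),\qquad \delta(t)=\sum_{j=1}^2e^{tA(j)},\qquad \alpha(t)=\sum_{j=1}^2\beta_je^{tA(j)} .$$ Then: 1. For all $n\ge 0$ and $t\in\mathbb R$, $\;Q_{n+2}(t)=\dfrac{\delta(t)^2-\alpha(t)^2}{4}\,Q_n(t)$. 2. For every $t\in\mathbb R$ one has $\delta(t)^2-\alpha(t)^2>0$, and the limit $c(t)=\lim_{n\to\infty}\frac1n\log Q_n(t)$ exists and equals $\frac12\log\big(\delta(t)^2-\alpha(t)^2\big)-\log 2$; the function $c:\mathbb R\to\mathbb R$ is differentiable. 3. The ergodic averages $\frac1nS_n$, $S_n(x)=\sum_{k=0}^{n-1}A(x_k)$, satisfy the large deviation principle under $\mu$ at speed $n$, with rate function the Legendre transform $I(s)=\sup_{t\in\mathbb R}(ts-c(t))\in[0,\infty]$. That is, $I\ge0$ is lower semicontinuous, its sublevel sets $\{I\le a\}$, $a\in\mathbb R$, are compact, and (with $\log 0=-\infty$)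 $$\limsup_{n\to\infty}\tfrac1n\log\mu\{\tfrac1nS_n\in F\}\le-\inf_{s\in F}I(s),\qquad \liminf_{n\to\infty}\tfrac1n\log\mu\{\tfrac1nS_n\in G\}\ge-\inf_{s\in G}I(s)$$ for every closed set $F\subseteq\mathbb R$ and every open set $G\subseteq\mathbb R$. -/

import Mathlib

open MeasureTheory Filter Topology Set

noncomputable section

namespace SpinChain

/-- The Pauli matrix `σ_x`. -/
def sigmaX : Matrix (Fin 2) (Fin 2) ℂ := !![0, 1; 1, 0]

/-- The tensor product `M₀ ⊗ M₁ ⊗ ⋯ ⊗ M_{n-1}` acting on `(ℂ²)^{⊗ n}`, as a matrix in the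
product basis, which is indexed by the strings `Fin n → Fin 2`. -/
def tensor {n : ℕ} (M : Fin n → Matrix (Fin 2) (Fin 2) ℂ) :
    Matrix (Fin n → Fin 2) (Fin n → Fin 2) ℂ :=
  Matrix.of fun x y => ∏ i, M i (x i) (y i)

/-- The Hamiltonian `H_n = ∑_{i=0}^{n-2} I^{⊗ i} ⊗ (σ_x ⊗ σ_x) ⊗ I^{⊗ (n-i-2)}`. -/
def hamiltonian (n : ℕ) : Matrix (Fin n → Fin 2) (Fin n → Fin 2) ℂ :=
  ∑ i ∈ Finset.range (n - 1),
    tensor fun k : Fin n => if (k : ℕ) = i ∨ (k : ℕ) = i + 1 then sigmaX else 1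

/-- The KMS state `M ↦ Tr (e^{-b H_n} M) / Tr (e^{-b H_n})` at inverse temperature `b`. -/
def kmsState (n : ℕ) (b : ℝ) (M : Matrix (Fin n → Fin 2) (Fin n → Fin 2) ℂ) : ℂ :=
  (NormedSpace.exp (-(b : ℂ) • hamiltonian n) * M).trace /
    (NormedSpace.exp (-(b : ℂ) • hamiltonian n)).trace

/-- The observable `L` of angle `θ`, with eigenvalues `1` and `-1`. -/
def observable (θ : ℝ) : Matrix (Fin 2) (Fin 2) ℂ :=
  !![((Real.cos θ ^ 2 - Real.sin θ ^ 2 : ℝ) : ℂ), ((2 * Real.cos θ * Real.sin θ : ℝ) : ℂ);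
     ((2 * Real.cos θ * Real.sin θ : ℝ) : ℂ), ((Real.sin θ ^ 2 - Real.cos θ ^ 2 : ℝ) : ℂ)]

/-- The orthonormal eigenbasis of `L`: `(cos θ, sin θ)` for the eigenvalue `1` (symbol `0`) and
`(-sin θ, cos θ)` for the eigenvalue `-1` (symbol `1`). -/
def eigenvector (θ : ℝ) : Fin 2 → Fin 2 → ℂ :=
  ![![(Real.cos θ : ℂ), (Real.sin θ : ℂ)], ![(-Real.sin θ : ℂ), (Real.cos θ : ℂ)]]

theorem observable_mulVec_eigenvector (θ : ℝ) (j : Fin 2) :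
    (observable θ).mulVec (eigenvector θ j) = (![1, -1] j : ℂ) • eigenvector θ j := by
  have h : (Complex.cos θ) ^ 2 = 1 - (Complex.sin θ) ^ 2 := by
    rw [← Complex.sin_sq_add_cos_sq (θ : ℂ)]; ring
  have h3 : (Complex.cos θ) ^ 3 = (1 - (Complex.sin θ) ^ 2) * Complex.cos θ := by
    rw [← h]; ring
  fin_cases j <;> ext i <;> fin_cases i <;>
    simp [observable, eigenvector, Matrix.mulVec, dotProduct, Fin.sum_univ_two] <;>
    ring_nf <;> simp only [h, h3] <;> ring

/-- The orthogonal projection `P_j` of `ℂ²` onto the line spanned by the `j`-th eigenvector. -/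
def eigenprojection (θ : ℝ) (j : Fin 2) : Matrix (Fin 2) (Fin 2) ℂ :=
  Matrix.vecMulVec (eigenvector θ j) (star (eigenvector θ j))

/-- The traces `β_j = Tr (σ_x P_j)`, that is `sin 2θ` and `-sin 2θ`. -/
def beta (θ : ℝ) : Fin 2 → ℝ := ![Real.sin (2 * θ), -Real.sin (2 * θ)]

theorem trace_sigmaX_mul_eigenprojection (θ : ℝ) (j : Fin 2) :
    (sigmaX * eigenprojection θ j).trace = (beta θ j : ℂ) := by
  simp only [Matrix.trace, Matrix.diag_apply, Matrix.mul_apply, Fin.sum_univ_two, eigenprojection,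
    Matrix.vecMulVec_apply, Pi.star_apply]
  fin_cases j <;>
    simp [sigmaX, beta, eigenvector, Complex.sin_two_mul, ← Complex.cos_conj,
      ← Complex.sin_conj] <;> ring

/-- `μ` is the zero temperature measure on the Bernoulli space: a probability measure that gives
every cylinder `[j₀, …, j_{n-1}]` the limit, as the inverse temperature tends to infinity, of the
probability `ω(P_{j₀} ⊗ ⋯ ⊗ P_{j_{n-1}})` of the string in the KMS state. -/
structure IsZeroTemperatureMeasure (θ : ℝ) (μ : Measure (ℕ → Fin 2)) : Prop where
  isProbabilityMeasure : IsProbabilityMeasure μ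
  tendsto_cylinder : ∀ (n : ℕ) (j : Fin n → Fin 2),
    Tendsto (fun b : ℝ => kmsState n b (tensor fun i => eigenprojection θ (j i))) atTop
      (𝓝 ((μ.real {x : ℕ → Fin 2 | ∀ i : Fin n, x i = j i} : ℝ) : ℂ))

/-- The shift on the Bernoulli space. -/
def shift (x : ℕ → Fin 2) : ℕ → Fin 2 := fun k => x (k + 1)

/-- `Q_n(t) = ∫ exp (t (A(x₀) + A(x₁) + ⋯ + A(x_n))) dμ(x)`: there are `n + 1` summands. -/
def Q (μ : Measure (ℕ → Fin 2)) (A : Fin 2 → ℝ) (n : ℕ) (t : ℝ) : ℝ :=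
  ∫ x, Real.exp (t * birkhoffSum shift (fun y => A (y 0)) (n + 1) x) ∂μ

/-- `δ(t) = ∑_j e^{t A(j)}`. -/
def delta (A : Fin 2 → ℝ) (t : ℝ) : ℝ := ∑ j, Real.exp (t * A j)

/-- `α(t) = ∑_j β_j e^{t A(j)}`. -/
def alpha (θ : ℝ) (A : Fin 2 → ℝ) (t : ℝ) : ℝ := ∑ j, beta θ j * Real.exp (t * A j)

/-- The Legendre transform `s ↦ sup_t (t s - c(t))`, with values in `[-∞, ∞]`. -/
def legendre (c : ℝ → ℝ) (s : ℝ) : EReal := ⨆ t : ℝ, ((t * s - c t : ℝ) : EReal)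

/-- The real random variables `X_n` satisfy under `μ` the large deviation principle at speed `n`
with the good rate function `I`. Here `ENNReal.log 0 = -∞`. -/
structure LargeDeviationPrinciple {Ω : Type*} [MeasurableSpace Ω] (μ : Measure Ω)
    (X : ℕ → Ω → ℝ) (I : ℝ → EReal) : Prop where
  nonneg : ∀ s, 0 ≤ I s
  lowerSemicontinuous : LowerSemicontinuous I
  isCompact_sublevel : ∀ a : ℝ, IsCompact {s | I s ≤ (a : EReal)}
  upper_bound : ∀ F : Set ℝ, IsClosed F →
    limsup (fun n : ℕ => (((n : ℝ)⁻¹ : ℝ) : EReal) * ENNReal.log (μ {x | X n x ∈ F})) atTop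
      ≤ -(⨅ s ∈ F, I s)
  lower_bound : ∀ G : Set ℝ, IsOpen G →
    -(⨅ s ∈ G, I s) ≤
      liminf (fun n : ℕ => (((n : ℝ)⁻¹ : ℝ) : EReal) * ENNReal.log (μ {x | X n x ∈ G})) atTop

end SpinChain

end

noncomputable section

namespace SpinChain

/-! In the eigenbasis of `σ_x` every term of `H_n` is diagonal, so the chain is a classical
antiferromagnetic Ising chain and the KMS state sees only the diagonal entries `(1 ± β_j) / 2` of
the projections (`kmsState_tensor_eigenprojection`). As `b → ∞` the Gibbs weights concentrate
equally on the two alternating configurations (`tendsto_gibbs_average`, `lt_energy`). Hence `μ` is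
the half-half mixture of two product measures whose site laws alternate.

Exponential moments are then averages of two products with alternating factors `(δ ± α) / 2`. Any
two consecutive factors multiply to `(δ² - α²) / 4`, which gives the two-step recursion and, on
taking logarithms, `c`.

Since `δ² - α² > 0`, `c` is finite and differentiable, and the large deviation principle is the
Gärtner–Ellis theorem (`largeDeviationPrinciple_legendre`). Its upper bound is Chernoff plus
compactness. Its lower bound combines a penalized maximization (`exists_hasDerivAt_near`) with
concentration of the exponential moment near the slope of `c` (`eventually_exp_le_measure`). -/

/-! ### Diagonalization of the Hamiltonian -/

theorem tensor_mul_tensor {n : ℕ} (M N : Fin n → Matrix (Fin 2) (Fin 2) ℂ) :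
    tensor M * tensor N = tensor fun i => M i * N i := by
  ext x y
  simp only [tensor, Matrix.mul_apply, Matrix.of_apply, ← Finset.prod_mul_distrib]
  rw [Finset.prod_univ_sum, Fintype.piFinset_univ]

theorem tensor_diagonal {n : ℕ} (d : Fin n → Fin 2 → ℂ) :
    tensor (fun i => Matrix.diagonal (d i)) = Matrix.diagonal fun x => ∏ i, d i (x i) := by
  ext x y
  by_cases h : x = y
  · subst h
    simp [tensor]
  · obtain ⟨i, hi⟩ := Function.ne_iff.1 h
    rw [Matrix.diagonal_apply_ne _ h]
    exact Finset.prod_eq_zero (Finset.mem_univ i) (Matrix.diagonal_apply_ne _ hi)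

theorem tensor_one (n : ℕ) : tensor (fun _ : Fin n => (1 : Matrix (Fin 2) (Fin 2) ℂ)) = 1 := by
  simp_rw [← Matrix.diagonal_one, tensor_diagonal, Finset.prod_const_one]

/-- The unnormalized Hadamard matrix, whose columns are eigenvectors of `σ_x`. -/
def hadamard : Matrix (Fin 2) (Fin 2) ℂ := !![1, 1; 1, -1]

/-- The eigenvalues of `σ_x`. -/
def spin : Fin 2 → ℝ := ![1, -1]

theorem hadamard_mul_half : hadamard * ((2⁻¹ : ℂ) • hadamard) = 1 := by
  ext i j
  fin_cases i <;> fin_cases j <;>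
    norm_num [hadamard, Matrix.mul_apply, Fin.sum_univ_two]

theorem half_mul_hadamard : ((2⁻¹ : ℂ) • hadamard) * hadamard = 1 := by
  rw [Matrix.smul_mul, ← Matrix.mul_smul, hadamard_mul_half]

theorem sigmaX_eq_conj :
    sigmaX = hadamard * Matrix.diagonal (fun a => (spin a : ℂ)) * ((2⁻¹ : ℂ) • hadamard) := by
  rw [Matrix.mul_smul]
  ext i j
  simp only [Matrix.smul_apply, Matrix.mul_apply, Fin.sum_univ_two]
  fin_cases i <;> fin_cases j <;> norm_num [hadamard, sigmaX, spin]

/-- Only diagonal entries are needed: `e^{-bH}` is diagonal in this basis, so the trace ignores the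
others. -/
theorem conj_eigenprojection_apply_self (θ : ℝ) (j a : Fin 2) :
    (((2⁻¹ : ℂ) • hadamard) * eigenprojection θ j * hadamard) a a =
      (((1 + spin a * beta θ j) / 2 : ℝ) : ℂ) := by
  have h : (Complex.sin θ) ^ 2 = 1 - (Complex.cos θ) ^ 2 := by
    rw [← Complex.sin_sq_add_cos_sq (θ : ℂ)]; ring
  rw [Matrix.smul_mul, Matrix.smul_mul]
  simp only [Matrix.smul_apply, Matrix.mul_apply, Fin.sum_univ_two, eigenprojection,
    Matrix.vecMulVec_apply, Pi.star_apply]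
  fin_cases a <;> fin_cases j <;>
    simp [hadamard, spin, beta, eigenvector, Complex.sin_two_mul, ← Complex.cos_conj,
      ← Complex.sin_conj] <;> ring_nf <;> rw [h] <;> ring

/-- The tensor power of the Hadamard matrix, as a unit. -/
def hadamardUnit (n : ℕ) : (Matrix (Fin n → Fin 2) (Fin n → Fin 2) ℂ)ˣ where
  val := tensor fun _ => hadamard
  inv := tensor fun _ => (2⁻¹ : ℂ) • hadamard
  val_inv := by simp_rw [tensor_mul_tensor, hadamard_mul_half, tensor_one]
  inv_val := by simp_rw [tensor_mul_tensor, half_mul_hadamard, tensor_one]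

/-- The energy of a configuration of spins of the antiferromagnetic Ising chain. -/
def energy (n : ℕ) (x : Fin n → Fin 2) : ℝ :=
  ∑ i ∈ Finset.range (n - 1),
    ∏ k : Fin n, if (k : ℕ) = i ∨ (k : ℕ) = i + 1 then spin (x k) else 1

/-- Identity factors are conjugated by the same Hadamard matrix as the `σ_x` factors, so one change
of basis diagonalizes all the terms at once. -/
theorem hamiltonian_eq_conj (n : ℕ) :
    hamiltonian n =
      (hadamardUnit n).val * Matrix.diagonal (fun x => (energy n x : ℂ)) * ((hadamardUnit n)⁻¹).val := by
  have hd : Matrix.diagonal (fun x => (energy n x : ℂ)) = ∑ i ∈ Finset.range (n - 1),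
      tensor fun k : Fin n => Matrix.diagonal fun a =>
        if (k : ℕ) = i ∨ (k : ℕ) = i + 1 then (spin a : ℂ) else 1 := by
    simp_rw [tensor_diagonal]
    ext x y
    by_cases h : x = y
    · subst h
      simp [energy, Matrix.sum_apply, apply_ite]
    · simp [Matrix.sum_apply, h]
  rw [hd, Finset.mul_sum, Finset.sum_mul]
  refine Finset.sum_congr rfl fun i _ => ?_
  change _ = tensor (fun _ => hadamard) * _ * tensor (fun _ => (2⁻¹ : ℂ) • hadamard)
  rw [tensor_mul_tensor, tensor_mul_tensor]
  congr 1
  funext k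
  split_ifs
  · exact sigmaX_eq_conj
  · rw [Matrix.diagonal_one, mul_one, hadamard_mul_half]

theorem exp_hamiltonian (n : ℕ) (b : ℝ) :
    NormedSpace.exp (-(b : ℂ) • hamiltonian n) =
      (hadamardUnit n).val * Matrix.diagonal (fun x => ((Real.exp (-b * energy n x) : ℝ) : ℂ)) *
        ((hadamardUnit n)⁻¹).val := by
  have h : -(b : ℂ) • hamiltonian n = hadamardUnit n *
      Matrix.diagonal (fun x => -(b : ℂ) * (energy n x : ℂ)) * ((hadamardUnit n)⁻¹).val := by
    rw [hamiltonian_eq_conj, ← Matrix.smul_mul, ← Matrix.mul_smul, ← Matrix.diagonal_smul]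
    rfl
  rw [h, Matrix.exp_units_conj, Matrix.exp_diagonal]
  congr 3
  funext x
  rw [NormedSpace.exp_def]
  simp [← Complex.exp_eq_exp_ℂ, ← NormedSpace.exp_def]

theorem trace_exp_hamiltonian_mul (n : ℕ) (b : ℝ) (M : Matrix (Fin n → Fin 2) (Fin n → Fin 2) ℂ) :
    (NormedSpace.exp (-(b : ℂ) • hamiltonian n) * M).trace =
      ∑ x, ((Real.exp (-b * energy n x) : ℝ) : ℂ) *
        (((hadamardUnit n)⁻¹).val * M * (hadamardUnit n).val) x x := by
  rw [exp_hamiltonian, mul_assoc, mul_assoc, Matrix.trace_mul_comm, mul_assoc]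
  simp [Matrix.trace, Matrix.diagonal_mul]

theorem kmsState_tensor_eigenprojection (θ : ℝ) (n : ℕ) (b : ℝ) (j : Fin n → Fin 2) :
    kmsState n b (tensor fun i => eigenprojection θ (j i)) =
      (((∑ x, Real.exp (-b * energy n x) * ∏ i, (1 + spin (x i) * beta θ (j i)) / 2) /
        ∑ x, Real.exp (-b * energy n x) : ℝ) : ℂ) := by
  -- The partition function is the case `M = 1`.
  have h1 := trace_exp_hamiltonian_mul n b 1
  rw [mul_one, mul_one, Units.inv_mul] at h1
  rw [kmsState, trace_exp_hamiltonian_mul, h1]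
  change (∑ x, _ * ((tensor fun _ => (2⁻¹ : ℂ) • hadamard) * _ *
    tensor fun _ => hadamard : Matrix _ _ ℂ) x x) / _ = _
  simp_rw [tensor_mul_tensor]
  simp only [tensor, Matrix.of_apply, conj_eigenprojection_apply_self, Matrix.one_apply_eq, mul_one]
  push_cast
  rfl

/-! ### Ground states and the zero temperature limit -/

/-- Gibbs averages on a finite configuration space converge to the average over ground states. -/
theorem tendsto_gibbs_average {X : Type*} [Fintype X] (E f : X → ℝ) (s : Finset X)
    (hs : s.Nonempty) (m : ℝ) (hEs : ∀ x ∈ s, E x = m) (hE : ∀ x ∉ s, m < E x) :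
    Tendsto (fun b : ℝ => (∑ x, Real.exp (-b * E x) * f x) / ∑ x, Real.exp (-b * E x)) atTop
      (𝓝 ((∑ x ∈ s, f x) / s.card)) := by
  classical
  -- Measuring energy from the ground level `m` makes the ground weights constant and the others
  -- decay; the common factor `e^{bm}` cancels in the quotient.
  have key (g : X → ℝ) : Tendsto (fun b : ℝ => ∑ x, Real.exp (-b * (E x - m)) * g x) atTop
      (𝓝 (∑ x ∈ s, g x)) := by
    rw [← Finset.sum_ite_mem_eq s g]
    refine tendsto_finsetSum _ fun x _ => ?_
    split_ifs with hx
    · simp [hEs x hx]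
    · have h : Tendsto (fun b : ℝ => Real.exp (-b * (E x - m))) atTop (𝓝 0) :=
        Real.tendsto_exp_atBot.comp
          (tendsto_neg_atTop_atBot.atBot_mul_const (sub_pos.2 (hE x hx)))
      simpa using h.mul_const (g x)
  have h1 := key fun _ => 1
  simp only [mul_one, Finset.sum_const, nsmul_eq_mul] at h1
  have h2 := (key f).div h1 (by exact_mod_cast hs.card_pos.ne')
  refine h2.congr fun b => ?_
  have h3 (x : X) : Real.exp (-b * (E x - m)) = Real.exp (b * m) * Real.exp (-b * E x) := by
    rw [← Real.exp_add]
    ring_nf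
  simp only [Pi.div_apply, h3, mul_assoc, ← Finset.mul_sum]
  exact mul_div_mul_left _ _ (Real.exp_pos _).ne'

/-- The two alternating configurations of spins. -/
def alternating (n : ℕ) (a : ℕ) (k : Fin n) : Fin 2 := Fin.ofNat 2 (k + a)

theorem spin_ofNat (m : ℕ) : spin (Fin.ofNat 2 m) = (-1) ^ m := by
  rcases Nat.even_or_odd' m with ⟨c, rfl | rfl⟩ <;> simp [spin, Fin.ofNat, pow_succ, pow_mul]

theorem spin_mul_spin (a b : Fin 2) : spin a * spin b = if a = b then 1 else -1 := by
  fin_cases a <;> fin_cases b <;> simp [spin]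

theorem energy_bond {n i : ℕ} (hi : i + 1 < n) (x : Fin n → Fin 2) :
    (∏ k : Fin n, if (k : ℕ) = i ∨ (k : ℕ) = i + 1 then spin (x k) else 1) =
      if x ⟨i, by omega⟩ = x ⟨i + 1, hi⟩ then 1 else -1 := by
  rw [Fintype.prod_eq_mul (⟨i, by omega⟩ : Fin n) ⟨i + 1, hi⟩ (by simp), ← spin_mul_spin]
  · simp
  · rintro k ⟨h1, h2⟩
    simp only [ne_eq, Fin.ext_iff] at h1 h2
    simp [h1, h2]

theorem energy_alternating (n a : ℕ) : energy n (alternating n a) = -((n - 1 : ℕ) : ℝ) := by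
  have h (i : ℕ) (hi : i ∈ Finset.range (n - 1)) :
      (∏ k : Fin n, if (k : ℕ) = i ∨ (k : ℕ) = i + 1 then spin (alternating n a k) else 1) = -1 := by
    rw [Finset.mem_range] at hi
    rw [energy_bond (by omega), if_neg]
    simp only [alternating, Fin.ofNat, Fin.ext_iff]
    omega
  rw [energy, Finset.sum_congr rfl h]
  simp

/-- Each bond contributes at least `-1`. If all bonds give `-1`, neighbours differ everywhere and
the first spin determines the configuration, which is then alternating. -/
theorem lt_energy {n : ℕ} (x : Fin n → Fin 2) (h0 : x ≠ alternating n 0)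
    (h1 : x ≠ alternating n 1) : -((n - 1 : ℕ) : ℝ) < energy n x := by
  obtain ⟨i, hi, hx⟩ : ∃ (i : ℕ) (hi : i + 1 < n), x ⟨i, by omega⟩ = x ⟨i + 1, hi⟩ := by
    by_contra! hne
    have hrec (hn : 0 < n) (k : ℕ) (hk : k < n) :
        (x ⟨k, hk⟩ : ℕ) = (k + (x ⟨0, hn⟩ : ℕ)) % 2 := by
      induction k with
      | zero => omega
      | succ k ih =>
        have h := hne k hk
        rw [ne_eq, Fin.ext_iff] at h
        specialize ih (by omega)
        omega
    rcases Nat.eq_zero_or_pos n with rfl | hn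
    · exact h0 (Subsingleton.elim _ _)
    · rcases (by omega : (x ⟨0, hn⟩ : ℕ) = 0 ∨ (x ⟨0, hn⟩ : ℕ) = 1) with h | h
      · refine h0 (funext fun k => Fin.ext ?_)
        simpa [h, alternating, Fin.ofNat] using hrec hn k k.2
      · refine h1 (funext fun k => Fin.ext ?_)
        simpa [h, alternating, Fin.ofNat] using hrec hn k k.2
  have hc : -((n - 1 : ℕ) : ℝ) = ∑ i ∈ Finset.range (n - 1), (-1 : ℝ) := by simp
  rw [hc]
  refine Finset.sum_lt_sum (fun k hk => ?_) ⟨i, Finset.mem_range.2 (by omega), ?_⟩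
  · rw [energy_bond (by rw [Finset.mem_range] at hk; omega)]
    split_ifs <;> norm_num
  · rw [energy_bond hi, if_pos hx]
    norm_num

/-- The probability `(1 ± β_j) / 2` of the symbol `j` at a site of the alternating ground state
whose spin is `(-1) ^ k`. -/
def siteProb (θ : ℝ) (k : ℕ) (j : Fin 2) : ℝ := (1 + (-1) ^ k * beta θ j) / 2

theorem tendsto_kmsState (θ : ℝ) (n : ℕ) (j : Fin n → Fin 2) :
    Tendsto (fun b : ℝ => kmsState n b (tensor fun i => eigenprojection θ (j i))) atTop
      (𝓝 (((∏ i : Fin n, siteProb θ i (j i) + ∏ i : Fin n, siteProb θ (i + 1) (j i)) / 2 : ℝ) :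
        ℂ)) := by
  simp_rw [kmsState_tensor_eigenprojection]
  refine (Complex.continuous_ofReal.tendsto _).comp ?_
  -- For `n = 0` the two alternating configurations coincide, so the count of two ground states
  -- needs `n > 0`.
  rcases Nat.eq_zero_or_pos n with rfl | hn
  · simp [energy]
  · have hne : alternating n 0 ≠ alternating n 1 := fun h => by
      simpa [alternating, Fin.ofNat] using congrFun h ⟨0, hn⟩
    have h := tendsto_gibbs_average (energy n)
      (fun x => ∏ i, (1 + spin (x i) * beta θ (j i)) / 2) {alternating n 0, alternating n 1}
      (by simp) (-((n - 1 : ℕ) : ℝ)) (by simp [energy_alternating])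
      (fun x hx => by
        simp only [Finset.mem_insert, Finset.mem_singleton, not_or] at hx
        exact lt_energy x hx.1 hx.2)
    rw [Finset.sum_pair hne, Finset.card_pair hne] at h
    simpa only [alternating, spin_ofNat, add_zero, siteProb, Nat.cast_ofNat] using h

/-! ### Existence and uniqueness of the zero temperature measure -/

theorem abs_beta_le_one (θ : ℝ) (j : Fin 2) : |beta θ j| ≤ 1 := by
  fin_cases j <;> simp [beta, Real.abs_sin_le_one]

theorem sum_beta (θ : ℝ) : ∑ j, beta θ j = 0 := by simp [beta]

theorem siteProb_nonneg (θ : ℝ) (k : ℕ) (j : Fin 2) : 0 ≤ siteProb θ k j := by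
  have h : |(-1) ^ k * beta θ j| ≤ 1 := by
    rw [abs_mul, abs_pow, abs_neg, abs_one, one_pow, one_mul]
    exact abs_beta_le_one θ j
  have := (abs_le.1 h).1
  rw [siteProb]
  linarith

theorem sum_siteProb (θ : ℝ) (k : ℕ) : ∑ j, siteProb θ k j = 1 := by
  simp only [siteProb, ← Finset.sum_div, Finset.sum_add_distrib, ← Finset.mul_sum, sum_beta]
  norm_num

/-- The law of the symbol at a site of spin `(-1) ^ k`. -/
def siteMeasure (θ : ℝ) (k : ℕ) : Measure (Fin 2) :=
  ∑ j, ENNReal.ofReal (siteProb θ k j) • Measure.dirac j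

theorem siteMeasure_singleton (θ : ℝ) (k : ℕ) (j : Fin 2) :
    siteMeasure θ k {j} = ENNReal.ofReal (siteProb θ k j) := by
  simp [siteMeasure, Set.indicator_apply]
  fin_cases j <;> simp

instance isProbabilityMeasure_siteMeasure (θ : ℝ) (k : ℕ) :
    IsProbabilityMeasure (siteMeasure θ k) := by
  constructor
  simp only [siteMeasure, Measure.coe_finsetSum, Finset.sum_apply, Measure.smul_apply,
    measure_univ, smul_eq_mul, mul_one]
  rw [← ENNReal.ofReal_sum_of_nonneg fun j _ => siteProb_nonneg θ k j, sum_siteProb,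
    ENNReal.ofReal_one]

/-- The law of independent symbols in the alternating ground state with spin `(-1) ^ a` at `0`. -/
def alternatingMeasure (θ : ℝ) (a : ℕ) : Measure (ℕ → Fin 2) :=
  Measure.infinitePi fun k => siteMeasure θ (k + a)

instance isProbabilityMeasure_alternatingMeasure (θ : ℝ) (a : ℕ) :
    IsProbabilityMeasure (alternatingMeasure θ a) := by
  unfold alternatingMeasure
  infer_instance

/-- The set of sequences that begin with the string `j`. -/
def cylinderSet {n : ℕ} (j : Fin n → Fin 2) : Set (ℕ → Fin 2) := {x | ∀ i : Fin n, x i = j i}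

theorem measurableSet_cylinderSet {n : ℕ} (j : Fin n → Fin 2) :
    MeasurableSet (cylinderSet j) := by
  simp only [cylinderSet, ofPred_forall]
  exact MeasurableSet.iInter fun i => measurableSet_eq_fun (measurable_pi_apply _) measurable_const

theorem alternatingMeasure_cylinderSet (θ : ℝ) (a : ℕ) {n : ℕ} (j : Fin n → Fin 2) :
    (alternatingMeasure θ a).real (cylinderSet j) = ∏ i : Fin n, siteProb θ (i + a) (j i) := by
  -- The cylinder is a box, constrained only in its first `n` coordinates.
  set t : ℕ → Set (Fin 2) := fun k => if h : k < n then {j ⟨k, h⟩} else univ with ht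
  have hc : cylinderSet j = Set.pi (Finset.range n) t := by
    ext x
    simp only [cylinderSet, mem_ofPred_eq, Set.mem_pi, Finset.coe_range, Set.mem_Iio, ht]
    refine ⟨fun h k hk => ?_, fun h k => ?_⟩
    · simpa [hk] using h ⟨k, hk⟩
    · simpa using h k k.2
  rw [hc, measureReal_def, alternatingMeasure, Measure.infinitePi_pi]
  · rw [← Fin.prod_univ_eq_prod_range (fun k => siteMeasure θ (k + a) (t k)) n, ENNReal.toReal_prod]
    refine Finset.prod_congr rfl fun i _ => ?_
    simp [ht, siteMeasure_singleton, siteProb_nonneg]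
  · intros
    exact MeasurableSet.of_discrete

/-- The zero temperature measure: the mixture of the laws of the two alternating ground states. -/
def zeroTemperatureMeasure (θ : ℝ) : Measure (ℕ → Fin 2) :=
  (2⁻¹ : ENNReal) • alternatingMeasure θ 0 + (2⁻¹ : ENNReal) • alternatingMeasure θ 1

instance isProbabilityMeasure_zeroTemperatureMeasure (θ : ℝ) :
    IsProbabilityMeasure (zeroTemperatureMeasure θ) := by
  constructor
  simp [zeroTemperatureMeasure, ENNReal.inv_two_add_inv_two]

theorem zeroTemperatureMeasure_cylinderSet (θ : ℝ) {n : ℕ} (j : Fin n → Fin 2) :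
    (zeroTemperatureMeasure θ).real (cylinderSet j) =
      (∏ i : Fin n, siteProb θ i (j i) + ∏ i : Fin n, siteProb θ (i + 1) (j i)) / 2 := by
  have h0 := alternatingMeasure_cylinderSet θ 0 j
  have h1 := alternatingMeasure_cylinderSet θ 1 j
  simp only [add_zero] at h0
  rw [← h0, ← h1]
  simp only [measureReal_def, zeroTemperatureMeasure, Measure.add_apply, Measure.smul_apply,
    smul_eq_mul]
  rw [ENNReal.toReal_add (by finiteness) (by finiteness), ENNReal.toReal_mul, ENNReal.toReal_mul,
    ENNReal.toReal_inv, ENNReal.toReal_ofNat]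
  ring

theorem isZeroTemperatureMeasure (θ : ℝ) :
    IsZeroTemperatureMeasure θ (zeroTemperatureMeasure θ) where
  isProbabilityMeasure := inferInstance
  tendsto_cylinder n j := by
    have h := tendsto_kmsState θ n j
    rwa [← zeroTemperatureMeasure_cylinderSet] at h

theorem generateFrom_cylinderSet :
    (inferInstance : MeasurableSpace (ℕ → Fin 2)) =
      MeasurableSpace.generateFrom {s | ∃ (n : ℕ) (j : Fin n → Fin 2), s = cylinderSet j} := by
  apply le_antisymm
  · refine iSup_le fun i => Measurable.comap_le ?_
    refine @measurable_to_countable' _ _ _ _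
      (MeasurableSpace.generateFrom {s | ∃ (n : ℕ) (j : Fin n → Fin 2), s = cylinderSet j}) _
      fun a => ?_
    have h : (fun x : ℕ → Fin 2 => x i) ⁻¹' {a} =
        ⋃ j : {j : Fin (i + 1) → Fin 2 // j (Fin.last i) = a}, cylinderSet j.1 := by
      ext x
      simp only [mem_preimage, mem_singleton_iff, mem_iUnion, cylinderSet, mem_ofPred_eq]
      refine ⟨fun h => ⟨⟨fun k => x k, by simpa using h⟩, fun k => rfl⟩, ?_⟩
      rintro ⟨j, hj⟩
      rw [← j.2, ← hj (Fin.last i), Fin.val_last]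
    rw [h]
    exact MeasurableSet.iUnion fun j => MeasurableSpace.measurableSet_generateFrom ⟨_, j.1, rfl⟩
  · refine MeasurableSpace.generateFrom_le ?_
    rintro s ⟨n, j, rfl⟩
    exact measurableSet_cylinderSet j

/-- Two cylinders that meet are nested: the longer string extends the shorter. -/
theorem isPiSystem_cylinderSet :
    IsPiSystem {s | ∃ (n : ℕ) (j : Fin n → Fin 2), s = cylinderSet j} := by
  have h {m n : ℕ} (hmn : m ≤ n) (i : Fin m → Fin 2) (j : Fin n → Fin 2)
      (hij : (cylinderSet i ∩ cylinderSet j).Nonempty) : cylinderSet j ⊆ cylinderSet i := by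
    obtain ⟨y, hyi, hyj⟩ := hij
    intro x hx k
    rw [← hyi k]
    exact (hx (k.castLE hmn)).trans (hyj (k.castLE hmn)).symm
  rintro _ ⟨m, i, rfl⟩ _ ⟨n, j, rfl⟩ hij
  rcases le_total m n with hmn | hmn
  · exact ⟨n, j, inter_eq_right.2 (h hmn i j hij)⟩
  · exact ⟨m, i, inter_eq_left.2 (h hmn j i (by rwa [inter_comm]))⟩

theorem IsZeroTemperatureMeasure.unique {θ : ℝ} {μ ν : Measure (ℕ → Fin 2)}
    (hμ : IsZeroTemperatureMeasure θ μ) (hν : IsZeroTemperatureMeasure θ ν) : μ = ν := by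
  have := hμ.isProbabilityMeasure
  have := hν.isProbabilityMeasure
  refine ext_of_generate_finite _ generateFrom_cylinderSet isPiSystem_cylinderSet ?_ (by simp)
  rintro _ ⟨n, j, rfl⟩
  have h := tendsto_nhds_unique (hμ.tendsto_cylinder n j) (hν.tendsto_cylinder n j)
  exact (measureReal_eq_measureReal_iff).1 (Complex.ofReal_injective h)

/-! ### Exponential moments of Birkhoff sums -/

/-- The exponential moment of the symbol at a site of spin `(-1) ^ k`. -/
def siteMoment (θ : ℝ) (A : Fin 2 → ℝ) (t : ℝ) (k : ℕ) : ℝ :=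
  ∑ j, siteProb θ k j * Real.exp (t * A j)

theorem birkhoffSum_shift (A : Fin 2 → ℝ) (n : ℕ) (x : ℕ → Fin 2) :
    birkhoffSum shift (fun y => A (y 0)) n x = ∑ i : Fin n, A (x i) := by
  have h (k : ℕ) : shift^[k] x = fun i => x (i + k) := by
    induction k with
    | zero => rfl
    | succ k ih =>
      rw [Function.iterate_succ_apply', ih]
      funext i
      simp only [shift]
      congr 1
      omega
  rw [birkhoffSum, Fin.sum_univ_eq_sum_range (fun i => A (x i)) n]
  simp [h]

/-- The integrand depends on the first `n` coordinates only, so the integral is a finite sum over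
strings; under each product law it factors over the sites. -/
theorem integral_exp_birkhoffSum (θ : ℝ) (A : Fin 2 → ℝ) (n : ℕ) (t : ℝ) :
    ∫ x, Real.exp (t * birkhoffSum shift (fun y => A (y 0)) n x) ∂zeroTemperatureMeasure θ =
      (∏ i : Fin n, siteMoment θ A t i + ∏ i : Fin n, siteMoment θ A t (i + 1)) / 2 := by
  have hr : Measurable fun (x : ℕ → Fin 2) (i : Fin n) => x i := by fun_prop
  simp_rw [birkhoffSum_shift]
  rw [← integral_map (f := fun j : Fin n → Fin 2 => Real.exp (t * ∑ i, A (j i)))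
    hr.aemeasurable (measurable_of_finite _).aestronglyMeasurable,
    integral_fintype .of_finite]
  have h (j : Fin n → Fin 2) :
      ((zeroTemperatureMeasure θ).map fun (x : ℕ → Fin 2) (i : Fin n) => x i).real {j} •
        Real.exp (t * ∑ i, A (j i)) =
      (∏ i : Fin n, siteProb θ i (j i) * Real.exp (t * A (j i)) +
        ∏ i : Fin n, siteProb θ (i + 1) (j i) * Real.exp (t * A (j i))) / 2 := by
    have hj : (fun (x : ℕ → Fin 2) (i : Fin n) => x i) ⁻¹' {j} = cylinderSet j := by
      ext x
      simp [cylinderSet, funext_iff]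
    rw [map_measureReal_apply hr (measurableSet_singleton j), hj,
      zeroTemperatureMeasure_cylinderSet, Finset.mul_sum, Real.exp_sum, Finset.prod_mul_distrib,
      Finset.prod_mul_distrib, smul_eq_mul]
    ring
  simp_rw [h, ← Finset.sum_div, Finset.sum_add_distrib, siteMoment]
  rw [Finset.prod_univ_sum, Finset.prod_univ_sum, Fintype.piFinset_univ]

/-! ### The Gärtner–Ellis theorem -/

section GaertnerEllis

open ProbabilityTheory

/-- Absorbs constant factors into an arbitrarily small loss in the exponential rate. -/
theorem eventually_le_exp_natCast_mul (C : ℝ) {κ : ℝ} (hκ : 0 < κ) :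
    ∀ᶠ n : ℕ in atTop, C ≤ Real.exp (n * κ) :=
  (Real.tendsto_exp_atTop.comp
    (tendsto_natCast_atTop_atTop.atTop_mul_const hκ)).eventually_ge_atTop C

theorem inv_mul_log_le {n : ℕ} (hn : 0 < n) {r : ℝ} {p : ENNReal}
    (h : p ≤ ENNReal.ofReal (Real.exp (n * r))) :
    (((n : ℝ)⁻¹ : ℝ) : EReal) * ENNReal.log p ≤ r := by
  have hn' : (n : ℝ) ≠ 0 := by positivity
  calc (((n : ℝ)⁻¹ : ℝ) : EReal) * ENNReal.log p
      ≤ (((n : ℝ)⁻¹ : ℝ) : EReal) * ENNReal.log (ENNReal.ofReal (Real.exp (n * r))) :=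
        mul_le_mul_of_nonneg_left (ENNReal.log_monotone h) (by exact_mod_cast by positivity)
    _ = r := by
        rw [ENNReal.log_ofReal_of_pos (Real.exp_pos _), Real.log_exp, ← EReal.coe_mul,
          inv_mul_cancel_left₀ hn']

theorem le_inv_mul_log {n : ℕ} (hn : 0 < n) {r : ℝ} {p : ENNReal}
    (h : ENNReal.ofReal (Real.exp (n * r)) ≤ p) :
    (r : EReal) ≤ (((n : ℝ)⁻¹ : ℝ) : EReal) * ENNReal.log p := by
  have hn' : (n : ℝ) ≠ 0 := by positivity
  calc (r : EReal) =
      (((n : ℝ)⁻¹ : ℝ) : EReal) * ENNReal.log (ENNReal.ofReal (Real.exp (n * r))) := by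
        rw [ENNReal.log_ofReal_of_pos (Real.exp_pos _), Real.log_exp, ← EReal.coe_mul,
          inv_mul_cancel_left₀ hn']
    _ ≤ _ :=
        mul_le_mul_of_nonneg_left (ENNReal.log_monotone h) (by exact_mod_cast by positivity)

theorem le_legendre (c : ℝ → ℝ) (t s : ℝ) : ((t * s - c t : ℝ) : EReal) ≤ legendre c s :=
  le_iSup (fun t : ℝ => ((t * s - c t : ℝ) : EReal)) t

theorem lowerSemicontinuous_legendre (c : ℝ → ℝ) : LowerSemicontinuous (legendre c) := by
  refine lowerSemicontinuous_iSup fun t => Continuous.lowerSemicontinuous ?_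
  exact continuous_coe_real_ereal.comp (by fun_prop)

theorem isCompact_legendre_sublevel (c : ℝ → ℝ) (a : ℝ) :
    IsCompact {s | legendre c s ≤ (a : EReal)} := by
  refine (isCompact_Icc (a := -(a + c (-1))) (b := a + c 1)).of_isClosed_subset
    ((lowerSemicontinuous_legendre c).isClosed_preimage a) fun s hs => ?_
  have h1 := EReal.coe_le_coe_iff.1 ((le_legendre c 1 s).trans hs)
  have h2 := EReal.coe_le_coe_iff.1 ((le_legendre c (-1) s).trans hs)
  constructor <;> linarith

/-- A closed set on which the Legendre transform exceeds `a` is covered by finitely many of the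
half lines `{x | a < t x - c t}`. -/
theorem exists_finite_halfLine_cover (c : ℝ → ℝ) {F : Set ℝ} (hF : IsClosed F) {a : ℝ}
    (h : ∀ s ∈ F, (a : EReal) < legendre c s) :
    ∃ T : Finset ℝ, ∀ s ∈ F, ∃ t ∈ T, a < t * s - c t := by
  classical
  -- Outside this interval `t = 1` or `t = -1` already works, so compactness is needed only inside.
  have hK : IsCompact (F ∩ Icc (-(a + c (-1))) (a + c 1)) := isCompact_Icc.inter_left hF
  obtain ⟨T, hT⟩ := hK.elim_finite_subcover (fun t : ℝ => {x : ℝ | a < t * x - c t})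
    (fun t => isOpen_lt continuous_const (by fun_prop)) fun s hs => by
      obtain ⟨t, ht⟩ := lt_iSup_iff.1 (h s hs.1)
      exact mem_iUnion.2 ⟨t, EReal.coe_lt_coe_iff.1 ht⟩
  refine ⟨insert 1 (insert (-1) T), fun s hs => ?_⟩
  by_cases h1 : a < 1 * s - c 1
  · exact ⟨1, by simp, h1⟩
  by_cases h2 : a < -1 * s - c (-1)
  · exact ⟨-1, by simp, h2⟩
  obtain ⟨t, ht, hts⟩ := mem_iUnion₂.1 (hT ⟨hs, by constructor <;> linarith⟩)
  exact ⟨t, by simp [ht], hts⟩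

/-- If the Legendre transform of a differentiable function is less than `r` at `s`, then there is a
tangent line of slope near `s` whose conjugate value is less than `r`. -/
theorem exists_hasDerivAt_near {c : ℝ → ℝ} (hc : Differentiable ℝ c) {s r η : ℝ} (hη : 0 < η)
    (hs : legendre c s < r) :
    ∃ t v : ℝ, HasDerivAt c v t ∧ |v - s| < η ∧ t * v - c t < r := by
  have hlt (t : ℝ) : t * s - c t < r := EReal.coe_lt_coe_iff.1 ((le_legendre c t s).trans_lt hs)
  set ε := η / 2 with hε
  have hpos (t : ℝ) : 0 < 1 + t ^ 2 := by positivity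
  have hle (t : ℝ) : |t| ≤ √(1 + t ^ 2) := Real.abs_le_sqrt (by linarith)
  -- The supremum of `t s - c t` need not be attained. The penalty `ε √(1 + t²)` forces a maximizer;
  -- its derivative is at most `ε` in absolute value, so the slope there is within `ε < η` of `s`,
  -- and it has the sign of `t`, so `t v ≤ t s`.
  obtain ⟨t, ht⟩ := Continuous.exists_forall_ge'
    (f := fun t => t * s - c t - ε * √(1 + t ^ 2)) (by have := hc.continuous; fun_prop) 0 <| by
      have h : Tendsto (fun t : ℝ => r - ε * ‖t‖) (cocompact ℝ) atBot :=
        tendsto_atBot_add_const_left _ r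
          (tendsto_neg_atTop_atBot.comp (tendsto_norm_cocompact_atTop.const_mul_atTop (by positivity)))
      refine (h.eventually_le_atBot _).mono fun t ht => le_trans ?_ ht
      have := mul_le_mul_of_nonneg_left (hle t) (by positivity : 0 ≤ ε)
      rw [Real.norm_eq_abs]
      linarith [hlt t]
  have hd : HasDerivAt (fun t => t * s - c t - ε * √(1 + t ^ 2))
      (1 * s - deriv c t - ε * (2 * t / (2 * √(1 + t ^ 2)))) t := by
    refine (((hasDerivAt_id t).mul_const s).sub (hc t).hasDerivAt).sub (HasDerivAt.const_mul ε ?_)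
    refine HasDerivAt.sqrt ?_ (hpos t).ne'
    simpa using (hasDerivAt_pow 2 t).const_add 1
  have h0 := IsLocalMax.hasDerivAt_eq_zero (Eventually.of_forall ht) hd
  rw [mul_div_mul_left _ _ two_ne_zero] at h0
  have hsq : 0 < √(1 + t ^ 2) := Real.sqrt_pos.2 (hpos t)
  refine ⟨t, deriv c t, (hc t).hasDerivAt, ?_, ?_⟩
  · have hv : deriv c t - s = -(ε * (t / √(1 + t ^ 2))) := by linarith
    have h1 : |t / √(1 + t ^ 2)| ≤ 1 := by
      rw [abs_div, abs_of_pos hsq]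
      exact (div_le_one hsq).2 (hle t)
    rw [hv, abs_neg, abs_mul, abs_of_pos (by positivity : 0 < ε)]
    nlinarith
  · have hv : t * deriv c t = t * s - ε * (t ^ 2 / √(1 + t ^ 2)) := by
      rw [show deriv c t = s - ε * (t / √(1 + t ^ 2)) by linarith]
      ring
    have : 0 ≤ ε * (t ^ 2 / √(1 + t ^ 2)) := by positivity
    linarith [hlt t]

variable {Ω : Type*} [MeasurableSpace Ω] {μ : Measure Ω} [IsProbabilityMeasure μ]
  {X : ℕ → Ω → ℝ} {c : ℝ → ℝ}

theorem eventually_mgf_le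
    (hint : ∀ (n : ℕ) (t : ℝ), Integrable (fun ω => Real.exp (n * t * X n ω)) μ)
    (hlim : ∀ t : ℝ, Tendsto (fun n : ℕ => (n : ℝ)⁻¹ * cgf (X n) μ (n * t)) atTop (𝓝 (c t)))
    {t r : ℝ} (hr : c t < r) :
    ∀ᶠ n : ℕ in atTop, mgf (X n) μ (n * t) ≤ Real.exp (n * r) := by
  filter_upwards [(hlim t).eventually_lt_const hr, eventually_gt_atTop 0] with n h hn
  rw [← exp_cgf (hint n t), Real.exp_le_exp]
  exact ((inv_mul_lt_iff₀ (by positivity)).1 h).le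

theorem eventually_le_mgf
    (hint : ∀ (n : ℕ) (t : ℝ), Integrable (fun ω => Real.exp (n * t * X n ω)) μ)
    (hlim : ∀ t : ℝ, Tendsto (fun n : ℕ => (n : ℝ)⁻¹ * cgf (X n) μ (n * t)) atTop (𝓝 (c t)))
    {t r : ℝ} (hr : r < c t) :
    ∀ᶠ n : ℕ in atTop, Real.exp (n * r) ≤ mgf (X n) μ (n * t) := by
  filter_upwards [(hlim t).eventually_const_lt hr, eventually_gt_atTop 0] with n h hn
  rw [← exp_cgf (hint n t), Real.exp_le_exp]
  exact ((lt_inv_mul_iff₀ (by positivity)).1 h).le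

/-- Chernoff's bound for `t * X n` at parameter `n`, which treats both signs of `t` together. -/
theorem eventually_measure_halfLine_le
    (hint : ∀ (n : ℕ) (t : ℝ), Integrable (fun ω => Real.exp (n * t * X n ω)) μ)
    (hlim : ∀ t : ℝ, Tendsto (fun n : ℕ => (n : ℝ)⁻¹ * cgf (X n) μ (n * t)) atTop (𝓝 (c t)))
    (t a : ℝ) {r : ℝ} (hr : -a < r) :
    ∀ᶠ n : ℕ in atTop, μ.real {ω | a < t * X n ω - c t} ≤ Real.exp (n * r) := by
  filter_upwards [eventually_mgf_le hint hlim (show c t < c t + (a + r) by linarith)] with n h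
  have hmgf : mgf (fun ω => t * X n ω) μ n = mgf (X n) μ (n * t) := by
    simp only [mgf, mul_assoc]
  calc μ.real {ω | a < t * X n ω - c t} ≤ μ.real {ω | a + c t ≤ t * X n ω} :=
        measureReal_mono fun ω hω => by
          simp only [mem_ofPred_eq] at hω ⊢
          linarith
    _ ≤ Real.exp (-n * (a + c t)) * mgf (X n) μ (n * t) := by
        rw [← hmgf]
        refine measure_ge_le_exp_mul_mgf _ n.cast_nonneg ?_
        simpa only [mul_assoc] using hint n t
    _ ≤ Real.exp (-n * (a + c t)) * Real.exp (n * (c t + (a + r))) := by gcongr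
    _ = Real.exp (n * r) := by
        rw [← Real.exp_add]
        ring_nf

theorem limsup_log_measure_le
    (hint : ∀ (n : ℕ) (t : ℝ), Integrable (fun ω => Real.exp (n * t * X n ω)) μ)
    (hlim : ∀ t : ℝ, Tendsto (fun n : ℕ => (n : ℝ)⁻¹ * cgf (X n) μ (n * t)) atTop (𝓝 (c t)))
    {F : Set ℝ} (hF : IsClosed F) :
    limsup (fun n : ℕ => (((n : ℝ)⁻¹ : ℝ) : EReal) * ENNReal.log (μ {x | X n x ∈ F})) atTop
      ≤ -(⨅ s ∈ F, legendre c s) := by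
  refine EReal.le_of_forall_lt_iff_le.1 fun r hr => ?_
  obtain ⟨q, hq, hqr⟩ := EReal.lt_iff_exists_real_btwn.1 hr
  rw [EReal.coe_lt_coe_iff] at hqr
  have hlt : ((-q : ℝ) : EReal) < ⨅ s ∈ F, legendre c s := by
    rw [EReal.coe_neg]
    exact EReal.neg_lt_comm.1 hq
  obtain ⟨T, hT⟩ := exists_finite_halfLine_cover c hF (a := -q) fun s hs =>
    hlt.trans_le (iInf₂_le s hs)
  -- Half of the gap `r - q` goes to Chernoff's bound, the other half absorbs the number of half
  -- lines.
  have hev : ∀ᶠ n : ℕ in atTop, ∀ t ∈ T,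
      μ.real {ω | -q < t * X n ω - c t} ≤ Real.exp (n * ((q + r) / 2)) :=
    (Finset.eventually_all T).2 fun t _ =>
      eventually_measure_halfLine_le hint hlim t (-q) (by linarith)
  refine limsup_le_of_le (h := ?_)
  filter_upwards [hev, eventually_gt_atTop 0,
    eventually_le_exp_natCast_mul T.card (show 0 < (r - q) / 2 by linarith)] with n h hn hcard
  refine inv_mul_log_le hn ?_
  rw [← ofReal_measureReal]
  refine ENNReal.ofReal_le_ofReal ?_
  calc μ.real {x | X n x ∈ F} ≤ μ.real (⋃ t ∈ T, {ω | -q < t * X n ω - c t}) :=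
        measureReal_mono (fun ω hω => by
          obtain ⟨t, ht, h⟩ := hT _ hω
          exact mem_iUnion₂.2 ⟨t, ht, h⟩) (measure_ne_top _ _)
    _ ≤ ∑ t ∈ T, μ.real {ω | -q < t * X n ω - c t} := measureReal_biUnion_finset_le _ _
    _ ≤ ∑ t ∈ T, Real.exp (n * ((q + r) / 2)) := Finset.sum_le_sum h
    _ = T.card * Real.exp (n * ((q + r) / 2)) := by rw [Finset.sum_const, nsmul_eq_mul]
    _ ≤ Real.exp (n * ((r - q) / 2)) * Real.exp (n * ((q + r) / 2)) := by gcongr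
    _ = Real.exp (n * r) := by
        rw [← Real.exp_add]
        ring_nf

/-- Where `X ≥ v + η` or `X ≤ v - η`, the factor `e^{nu(X - v - η)}` or `e^{nu(v - η - X)}` is at
least `1`; inserting it bounds the tails by moments at `t ± u`, without a change of measure. -/
theorem mgf_le_measure_add
    (hX : ∀ n, Measurable (X n))
    (hint : ∀ (n : ℕ) (t : ℝ), Integrable (fun ω => Real.exp (n * t * X n ω)) μ)
    (n : ℕ) (t v : ℝ) {u η : ℝ} (hu : 0 ≤ u) :
    mgf (X n) μ (n * t) ≤
      μ.real {ω | |X n ω - v| < η} * Real.exp (n * (t * v + |t| * η)) +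
        Real.exp (-(n * (u * (v + η)))) * mgf (X n) μ (n * (t + u)) +
        Real.exp (n * (u * (v - η))) * mgf (X n) μ (n * (t - u)) := by
  have hS : MeasurableSet {ω | |X n ω - v| < η} :=
    measurableSet_lt ((hX n).sub_const v).abs measurable_const
  have hi1 : Integrable ({ω | |X n ω - v| < η}.indicator
      fun _ => Real.exp (n * (t * v + |t| * η))) μ := (integrable_const _).indicator hS
  have hi2 := (hint n (t + u)).const_mul (Real.exp (-(n * (u * (v + η)))))
  have hi3 := (hint n (t - u)).const_mul (Real.exp (n * (u * (v - η))))
  have h1 : μ.real {ω | |X n ω - v| < η} * Real.exp (n * (t * v + |t| * η)) =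
      ∫ ω, {ω | |X n ω - v| < η}.indicator (fun _ => Real.exp (n * (t * v + |t| * η))) ω ∂μ := by
    rw [integral_indicator_const _ hS, smul_eq_mul]
  rw [h1, mgf, mgf, mgf, ← integral_const_mul, ← integral_const_mul]
  refine (integral_mono (hint n t) ((hi1.add hi2).add hi3) fun ω => ?_).trans_eq
    ((integral_add' (hi1.add hi2) hi3).trans (congrArg₂ (· + ·) (integral_add' hi1 hi2) rfl))
  have hn : (0 : ℝ) ≤ n := n.cast_nonneg
  have e2 := Real.exp_pos (-(n * (u * (v + η))) + n * (t + u) * X n ω)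
  have e3 := Real.exp_pos (n * (u * (v - η)) + n * (t - u) * X n ω)
  simp only [Pi.add_apply, ← Real.exp_add]
  by_cases hω : |X n ω - v| < η
  · rw [indicator_of_mem (s := {ω | |X n ω - v| < η}) hω]
    have : Real.exp (n * t * X n ω) ≤ Real.exp (n * (t * v + |t| * η)) := by
      rw [Real.exp_le_exp, mul_assoc]
      refine mul_le_mul_of_nonneg_left ?_ hn
      have h2 : t * (X n ω - v) ≤ |t| * η := (le_abs_self _).trans
        (by rw [abs_mul]; exact mul_le_mul_of_nonneg_left hω.le (abs_nonneg t))
      linarith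
    linarith
  · rw [indicator_of_notMem (s := {ω | |X n ω - v| < η}) hω, zero_add]
    rcases le_abs.1 (not_lt.1 hω) with h | h
    · have : Real.exp (n * t * X n ω) ≤
          Real.exp (-(n * (u * (v + η))) + n * (t + u) * X n ω) := by
        rw [Real.exp_le_exp]
        have := mul_nonneg (mul_nonneg hn hu) (sub_nonneg.2 h)
        linarith
      linarith
    · have : Real.exp (n * t * X n ω) ≤
          Real.exp (n * (u * (v - η)) + n * (t - u) * X n ω) := by
        rw [Real.exp_le_exp]
        have := mul_nonneg (mul_nonneg hn hu) (sub_nonneg.2 h)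
        linarith
      linarith

/-- Differentiability at `t` makes both tail terms exponentially smaller than the moment at `t`, so
that moment is carried by the part where `X n` is near `v`. -/
theorem eventually_exp_le_measure (hX : ∀ n, Measurable (X n))
    (hint : ∀ (n : ℕ) (t : ℝ), Integrable (fun ω => Real.exp (n * t * X n ω)) μ)
    (hlim : ∀ t : ℝ, Tendsto (fun n : ℕ => (n : ℝ)⁻¹ * cgf (X n) μ (n * t)) atTop (𝓝 (c t)))
    {t v : ℝ} (hd : HasDerivAt c v t) {G : Set ℝ} (hG : G ∈ 𝓝 v) {r : ℝ} (hr : r < c t - t * v) :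
    ∀ᶠ n : ℕ in atTop, Real.exp (n * r) ≤ μ.real {ω | X n ω ∈ G} := by
  obtain ⟨η₀, hη₀, hball⟩ := Metric.mem_nhds_iff.1 hG
  -- One `κ` each pays for `|t| * η`, for `ρ` and for the factor `2`.
  obtain ⟨κ, hκ, hκr⟩ : ∃ κ : ℝ, 0 < κ ∧ r + 3 * κ = c t - t * v :=
    ⟨(c t - t * v - r) / 3, by linarith, by ring⟩
  obtain ⟨η, hη, hηη₀, htη⟩ : ∃ η : ℝ, 0 < η ∧ η ≤ η₀ ∧ |t| * η ≤ κ := by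
    refine ⟨min η₀ (κ / (|t| + 1)), by positivity, min_le_left _ _, ?_⟩
    calc |t| * min η₀ (κ / (|t| + 1)) ≤ (|t| + 1) * (κ / (|t| + 1)) := by
          gcongr
          · linarith
          · exact min_le_right _ _
      _ = κ := by field_simp
  obtain ⟨u, hu, hu1, hu2⟩ : ∃ u : ℝ, 0 < u ∧ c (t + u) ≤ c t + u * v + u * η / 2 ∧
      c (t - u) ≤ c t - u * v + u * η / 2 := by
    have h := (hasDerivAt_iff_isLittleO_nhds_zero.1 hd).bound (half_pos hη)
    obtain ⟨δ, hδ, hsub⟩ := Metric.eventually_nhds_iff.1 h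
    have hb (h : ℝ) (hh : |h| < δ) : c (t + h) ≤ c t + h * v + η / 2 * |h| := by
      have h1 := (le_abs_self _).trans (hsub (show dist h 0 < δ by simpa using hh))
      rw [smul_eq_mul, Real.norm_eq_abs] at h1
      linarith
    refine ⟨δ / 2, by positivity, ?_, ?_⟩
    · have := hb (δ / 2) (by rw [abs_of_pos (by positivity)]; linarith)
      rw [abs_of_pos (by positivity)] at this
      linarith
    · have := hb (-(δ / 2)) (by rw [abs_neg, abs_of_pos (by positivity)]; linarith)
      rw [abs_neg, abs_of_pos (by positivity), ← sub_eq_add_neg] at this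
      linarith
  -- The tails have rate `c t - u η / 2` plus the slack `ε` allowed in the moments, that is `c t -
  -- ε`. With `ρ ≤ ε / 2`, each tail is eventually at most a quarter of `e^{n(c t - ρ)}`.
  set ε := u * η / 4 with hε
  have hε0 : 0 < ε := by positivity
  set ρ := min κ (ε / 2) with hρ
  have hρ0 : 0 < ρ := by positivity
  filter_upwards [eventually_le_mgf hint hlim (show c t - ρ < c t by linarith),
    eventually_mgf_le hint hlim (show c (t + u) < c t + u * v + u * η / 2 + ε by linarith),
    eventually_mgf_le hint hlim (show c (t - u) < c t - u * v + u * η / 2 + ε by linarith),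
    eventually_le_exp_natCast_mul 4 (show 0 < ε / 2 by positivity),
    eventually_le_exp_natCast_mul 2 hκ] with n h0 h1 h2 h4 h5
  have hn : (0 : ℝ) ≤ n := n.cast_nonneg
  have key := mgf_le_measure_add (μ := μ) hX hint n t v (u := u) (η := η) hu.le
  have hmono : μ.real {ω | |X n ω - v| < η} ≤ μ.real {ω | X n ω ∈ G} :=
    measureReal_mono fun ω hω => hball (by
      rw [Metric.mem_ball, Real.dist_eq]
      exact lt_of_lt_of_le hω hηη₀)
  have b1 : Real.exp (-(n * (u * (v + η)))) * mgf (X n) μ (n * (t + u)) ≤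
      Real.exp (n * (c t - ε)) := by
    refine (mul_le_mul_of_nonneg_left h1 (Real.exp_pos _).le).trans_eq ?_
    rw [← Real.exp_add, hε]
    ring_nf
  have b2 : Real.exp (n * (u * (v - η))) * mgf (X n) μ (n * (t - u)) ≤
      Real.exp (n * (c t - ε)) := by
    refine (mul_le_mul_of_nonneg_left h2 (Real.exp_pos _).le).trans_eq ?_
    rw [← Real.exp_add, hε]
    ring_nf
  have b3 : 4 * Real.exp (n * (c t - ε)) ≤ Real.exp (n * (c t - ρ)) := by
    calc 4 * Real.exp (n * (c t - ε)) ≤ Real.exp (n * (ε / 2)) * Real.exp (n * (c t - ε)) := by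
          gcongr
      _ = Real.exp (n * (c t - ε / 2)) := by
          rw [← Real.exp_add]
          ring_nf
      _ ≤ Real.exp (n * (c t - ρ)) := by
          gcongr
          exact min_le_right _ _
  have b4 : Real.exp (n * (c t - ρ)) ≤
      2 * (μ.real {ω | |X n ω - v| < η} * Real.exp (n * (t * v + |t| * η))) := by linarith
  have b5 : 2 * Real.exp (n * r) * Real.exp (n * (t * v + |t| * η)) ≤ Real.exp (n * (c t - ρ)) := by
    calc 2 * Real.exp (n * r) * Real.exp (n * (t * v + |t| * η))
        ≤ Real.exp (n * κ) * Real.exp (n * r) * Real.exp (n * (t * v + |t| * η)) := by gcongr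
      _ = Real.exp (n * (κ + r + (t * v + |t| * η))) := by
          rw [← Real.exp_add, ← Real.exp_add]
          ring_nf
      _ ≤ Real.exp (n * (c t - ρ)) := by
          have : ρ ≤ κ := min_le_left _ _
          refine Real.exp_le_exp.2 (mul_le_mul_of_nonneg_left ?_ hn)
          linarith
  refine le_trans ?_ hmono
  have hpos := Real.exp_pos (n * (t * v + |t| * η))
  refine le_of_mul_le_mul_right ?_ hpos
  linarith

theorem le_liminf_log_measure (hX : ∀ n, Measurable (X n))
    (hint : ∀ (n : ℕ) (t : ℝ), Integrable (fun ω => Real.exp (n * t * X n ω)) μ)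
    (hlim : ∀ t : ℝ, Tendsto (fun n : ℕ => (n : ℝ)⁻¹ * cgf (X n) μ (n * t)) atTop (𝓝 (c t)))
    (hc : Differentiable ℝ c) {G : Set ℝ} (hG : IsOpen G) :
    -(⨅ s ∈ G, legendre c s) ≤
      liminf (fun n : ℕ => (((n : ℝ)⁻¹ : ℝ) : EReal) * ENNReal.log (μ {x | X n x ∈ G})) atTop := by
  refine EReal.ge_of_forall_gt_iff_ge.1 fun r hr => ?_
  have hlt : ⨅ s ∈ G, legendre c s < ((-r : ℝ) : EReal) := by
    rw [EReal.coe_neg]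
    exact EReal.lt_neg_comm.1 hr
  obtain ⟨s, hs⟩ := iInf_lt_iff.1 hlt
  obtain ⟨hsG, hs⟩ := iInf_lt_iff.1 hs
  obtain ⟨η, hη, hball⟩ := Metric.isOpen_iff.1 hG s hsG
  obtain ⟨t, v, hd, hv, hlt⟩ := exists_hasDerivAt_near hc hη hs
  have hvG : G ∈ 𝓝 v := hG.mem_nhds (hball (by rwa [Metric.mem_ball, Real.dist_eq]))
  refine le_liminf_of_le (h := ?_)
  filter_upwards [eventually_exp_le_measure hX hint hlim hd hvG (show r < c t - t * v by linarith),
    eventually_gt_atTop 0] with n h hn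
  refine le_inv_mul_log hn ?_
  rw [← ofReal_measureReal]
  exact ENNReal.ofReal_le_ofReal h

/-- **Gärtner–Ellis theorem** on the real line, for a finite and differentiable limit of the scaled
cumulant generating functions. -/
theorem largeDeviationPrinciple_legendre (hX : ∀ n, Measurable (X n))
    (hint : ∀ (n : ℕ) (t : ℝ), Integrable (fun ω => Real.exp (n * t * X n ω)) μ)
    (hlim : ∀ t : ℝ, Tendsto (fun n : ℕ => (n : ℝ)⁻¹ * cgf (X n) μ (n * t)) atTop (𝓝 (c t)))
    (hc : Differentiable ℝ c) : LargeDeviationPrinciple μ X (legendre c) where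
  nonneg s := by
    have h0 : c 0 = 0 := tendsto_nhds_unique (hlim 0) (by simp)
    simpa [h0] using le_legendre c 0 s
  lowerSemicontinuous := lowerSemicontinuous_legendre c
  isCompact_sublevel := isCompact_legendre_sublevel c
  upper_bound _ hF := limsup_log_measure_le hint hlim hF
  lower_bound _ hG := le_liminf_log_measure hX hint hlim hc hG

end GaertnerEllis

/-! ### The two-step recursion and the limit `c` -/

theorem siteMoment_eq (θ : ℝ) (A : Fin 2 → ℝ) (t : ℝ) (k : ℕ) :
    siteMoment θ A t k = (delta A t + (-1) ^ k * alpha θ A t) / 2 := by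
  simp only [siteMoment, siteProb, delta, alpha, Fin.sum_univ_two]
  ring

theorem siteMoment_mul_succ (θ : ℝ) (A : Fin 2 → ℝ) (t : ℝ) (k : ℕ) :
    siteMoment θ A t k * siteMoment θ A t (k + 1) =
      (delta A t ^ 2 - alpha θ A t ^ 2) / 4 := by
  have h : ((-1 : ℝ) ^ k) ^ 2 = 1 := by rw [← pow_mul, mul_comm, pow_mul]; simp
  rw [siteMoment_eq, siteMoment_eq, pow_succ]
  linear_combination (-(alpha θ A t ^ 2) / 4) * h

/-- At `θ = π / 4` one of the weights `1 ± sin 2θ` vanishes, but `1 + sin 2θ` stays positive. -/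
theorem siteMoment_pos {θ : ℝ} (hθ : θ ∈ Ioo (0 : ℝ) (Real.pi / 2)) (A : Fin 2 → ℝ) (t : ℝ)
    (k : ℕ) : 0 < siteMoment θ A t k := by
  have h0 : 0 < Real.sin (2 * θ) :=
    Real.sin_pos_of_pos_of_lt_pi (by linarith [hθ.1]) (by linarith [hθ.2])
  have h1 := Real.sin_le_one (2 * θ)
  have e0 := Real.exp_pos (t * A 0)
  have e1 := Real.exp_pos (t * A 1)
  have p0 := mul_nonneg (sub_nonneg.2 h1) e0.le
  have p1 := mul_nonneg (sub_nonneg.2 h1) e1.le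
  have q0 := mul_pos h0 e0
  have q1 := mul_pos h0 e1
  rw [siteMoment_eq, delta, alpha]
  simp only [Fin.sum_univ_two, beta, Matrix.cons_val_zero, Matrix.cons_val_one]
  rcases neg_one_pow_eq_or ℝ k with h | h <;> rw [h] <;> linarith

theorem delta_sq_sub_alpha_sq_pos {θ : ℝ} (hθ : θ ∈ Ioo (0 : ℝ) (Real.pi / 2)) (A : Fin 2 → ℝ)
    (t : ℝ) : 0 < delta A t ^ 2 - alpha θ A t ^ 2 := by
  have h := mul_pos (siteMoment_pos hθ A t 0) (siteMoment_pos hθ A t 1)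
  rw [siteMoment_mul_succ] at h
  linarith

/-- The last two factors of either product multiply to the same constant, whatever the parity. -/
theorem integral_exp_birkhoffSum_add_two (θ : ℝ) (A : Fin 2 → ℝ) (n : ℕ) (t : ℝ) :
    ∫ x, Real.exp (t * birkhoffSum shift (fun y => A (y 0)) (n + 2) x) ∂zeroTemperatureMeasure θ =
      (delta A t ^ 2 - alpha θ A t ^ 2) / 4 *
        ∫ x, Real.exp (t * birkhoffSum shift (fun y => A (y 0)) n x) ∂zeroTemperatureMeasure θ := by
  have h0 := siteMoment_mul_succ θ A t n
  have h1 := siteMoment_mul_succ θ A t (n + 1)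
  simp only [integral_exp_birkhoffSum, Fin.prod_univ_castSucc, Fin.val_castSucc, Fin.val_last]
  linear_combination (∏ i : Fin n, siteMoment θ A t i) / 2 * h0 +
    (∏ i : Fin n, siteMoment θ A t (i + 1)) / 2 * h1

theorem integral_exp_birkhoffSum_pos {θ : ℝ} (hθ : θ ∈ Ioo (0 : ℝ) (Real.pi / 2))
    (A : Fin 2 → ℝ) (n : ℕ) (t : ℝ) :
    0 < ∫ x, Real.exp (t * birkhoffSum shift (fun y => A (y 0)) n x) ∂zeroTemperatureMeasure θ := by
  have h (a : ℕ) : 0 < ∏ i : Fin n, siteMoment θ A t (i + a) :=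
    Finset.prod_pos fun i _ => siteMoment_pos hθ A t _
  have h0 := h 0
  have h1 := h 1
  simp only [add_zero] at h0
  rw [integral_exp_birkhoffSum]
  positivity

theorem tendsto_inv_mul_of_add_two {a : ℕ → ℝ} {d : ℝ} (h : ∀ n, a (n + 2) = d + a n) :
    Tendsto (fun n : ℕ => (n : ℝ)⁻¹ * a n) atTop (𝓝 (d / 2)) := by
  -- The sequence `a n - n d / 2` is 2-periodic, hence bounded by its first two values.
  have hb (n : ℕ) : |a n - n * (d / 2)| ≤ |a 0| + |a 1 - d / 2| := by
    induction n using Nat.twoStepInduction with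
    | zero => simp
    | one => simp
    | more n ih _ =>
      rw [h]
      convert ih using 2
      push_cast
      ring
  have h0 : Tendsto (fun n : ℕ => (n : ℝ)⁻¹ * (a n - n * (d / 2))) atTop (𝓝 0) :=
    tendsto_inv_atTop_nhds_zero_nat.zero_mul_isBoundedUnder_le
      (isBoundedUnder_of ⟨_, hb⟩)
  have h1 := h0.add_const (d / 2)
  rw [zero_add] at h1
  refine h1.congr' ?_
  filter_upwards [eventually_gt_atTop 0] with n hn
  have : (n : ℝ) ≠ 0 := by positivity
  field_simp
  ring

theorem tendsto_inv_mul_log_of_add_two {a : ℕ → ℝ} {D : ℝ} (hD : 0 < D) (ha : ∀ n, 0 < a n)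
    (h : ∀ n, a (n + 2) = D / 4 * a n) :
    Tendsto (fun n : ℕ => (n : ℝ)⁻¹ * Real.log (a n)) atTop
      (𝓝 (1 / 2 * Real.log D - Real.log 2)) := by
  have h4 : Real.log 4 = 2 * Real.log 2 := by
    rw [show (4 : ℝ) = 2 ^ 2 by norm_num, Real.log_pow, Nat.cast_ofNat]
  have hlim := tendsto_inv_mul_of_add_two (a := fun n => Real.log (a n)) (d := Real.log (D / 4))
    fun n => by rw [h, Real.log_mul (by positivity) (ha n).ne']
  rw [Real.log_div hD.ne' (by norm_num), h4] at hlim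
  convert hlim using 2
  ring

theorem measurable_birkhoffAverage_shift (A : Fin 2 → ℝ) (n : ℕ) :
    Measurable (birkhoffAverage ℝ shift (fun y => A (y 0)) n) := by
  have h : birkhoffAverage ℝ shift (fun y => A (y 0)) n =
      fun x => (n : ℝ)⁻¹ * ∑ i : Fin n, A (x i) := funext fun x => by
    rw [birkhoffAverage, birkhoffSum_shift, smul_eq_mul]
  rw [h]
  have hr : Measurable fun (x : ℕ → Fin 2) (i : Fin n) => x i := by fun_prop
  exact (measurable_of_finite fun j : Fin n → Fin 2 => (n : ℝ)⁻¹ * ∑ i, A (j i)).comp hr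

theorem integrable_exp_birkhoffAverage (μ : Measure (ℕ → Fin 2)) [IsFiniteMeasure μ]
    (A : Fin 2 → ℝ) (n : ℕ) (t : ℝ) :
    Integrable (fun x => Real.exp (t * birkhoffAverage ℝ shift (fun y => A (y 0)) n x)) μ := by
  have hr : Measurable fun (x : ℕ → Fin 2) (i : Fin n) => x i := by fun_prop
  have h : Integrable (fun j : Fin n → Fin 2 => Real.exp (t * ((n : ℝ)⁻¹ • ∑ i, A (j i))))
    (μ.map fun (x : ℕ → Fin 2) (i : Fin n) => x i) := .of_finite
  simp only [birkhoffAverage, birkhoffSum_shift]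
  exact h.comp_measurable hr

theorem natCast_mul_birkhoffAverage (A : Fin 2 → ℝ) (n : ℕ) (t : ℝ) (x : ℕ → Fin 2) :
    n * t * birkhoffAverage ℝ shift (fun y => A (y 0)) n x =
      t * birkhoffSum shift (fun y => A (y 0)) n x := by
  -- For `n = 0` both sides vanish.
  rcases Nat.eq_zero_or_pos n with rfl | hn
  · simp
  · have : (n : ℝ) ≠ 0 := by positivity
    rw [birkhoffAverage, smul_eq_mul]
    field_simp

theorem differentiable_log_delta_sq_sub_alpha_sq {θ : ℝ} (hθ : θ ∈ Ioo (0 : ℝ) (Real.pi / 2))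
    (A : Fin 2 → ℝ) :
    Differentiable ℝ fun t => 1 / 2 * Real.log (delta A t ^ 2 - alpha θ A t ^ 2) - Real.log 2 := by
  have h : Differentiable ℝ fun t => delta A t ^ 2 - alpha θ A t ^ 2 := by
    unfold delta alpha
    fun_prop
  exact ((h.log fun t => (delta_sq_sub_alpha_sq_pos hθ A t).ne').const_mul _).sub_const _

end SpinChain

end

theorem mainTheorem3 (θ : ℝ) (hθ : θ ∈ Set.Ioo (0 : ℝ) (Real.pi / 2)) :
    ∃ μ : Measure (ℕ → Fin 2),
      SpinChain.IsZeroTemperatureMeasure θ μ ∧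
      (∀ ν : Measure (ℕ → Fin 2), SpinChain.IsZeroTemperatureMeasure θ ν → ν = μ) ∧
      ∀ A : Fin 2 → ℝ,
        (∀ (n : ℕ) (t : ℝ),
          SpinChain.Q μ A (n + 2) t =
            (SpinChain.delta A t ^ 2 - SpinChain.alpha θ A t ^ 2) / 4 * SpinChain.Q μ A n t) ∧
        (∀ t : ℝ, 0 < SpinChain.delta A t ^ 2 - SpinChain.alpha θ A t ^ 2) ∧
        ∃ c : ℝ → ℝ,
          (∀ t : ℝ,
            Tendsto (fun n : ℕ => 1 / (n : ℝ) * Real.log (SpinChain.Q μ A n t)) atTop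
              (𝓝 (c t))) ∧
          (∀ t : ℝ,
            c t = 1 / 2 * Real.log (SpinChain.delta A t ^ 2 - SpinChain.alpha θ A t ^ 2)
              - Real.log 2) ∧
          Differentiable ℝ c ∧
          SpinChain.LargeDeviationPrinciple μ
            (fun (n : ℕ) (x : ℕ → Fin 2) =>
              birkhoffAverage ℝ SpinChain.shift (fun y => A (y 0)) n x)
            (SpinChain.legendre c) := by
  open SpinChain in
  refine ⟨zeroTemperatureMeasure θ, isZeroTemperatureMeasure θ,
    fun ν hν => hν.unique (isZeroTemperatureMeasure θ), fun A =>
    ⟨fun n t => integral_exp_birkhoffSum_add_two θ A (n + 1) t, delta_sq_sub_alpha_sq_pos hθ A,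
      fun t => 1 / 2 * Real.log (delta A t ^ 2 - alpha θ A t ^ 2) - Real.log 2, fun t => ?_,
      fun t => rfl, differentiable_log_delta_sq_sub_alpha_sq hθ A, ?_⟩⟩
  -- `Q` at `n` has `n + 1` summands. Dividing by `n` is harmless, since the limit uses only
  -- positivity and the recursion.
  · simpa only [one_div, Q] using tendsto_inv_mul_log_of_add_two (delta_sq_sub_alpha_sq_pos hθ A t)
      (fun n => integral_exp_birkhoffSum_pos hθ A (n + 1) t)
      fun n => integral_exp_birkhoffSum_add_two θ A (n + 1) t
  · refine largeDeviationPrinciple_legendre (measurable_birkhoffAverage_shift A)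
      (fun n t => integrable_exp_birkhoffAverage _ A n (n * t)) (fun t => ?_)
      (differentiable_log_delta_sq_sub_alpha_sq hθ A)
    simp only [ProbabilityTheory.cgf, ProbabilityTheory.mgf, natCast_mul_birkhoffAverage]
    exact tendsto_inv_mul_log_of_add_two (delta_sq_sub_alpha_sq_pos hθ A t)
      (fun n => integral_exp_birkhoffSum_pos hθ A n t)
      fun n => integral_exp_birkhoffSum_add_two θ A n t
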